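/- Let $d\ge 1$, let $\mathcal A$ be a finite alphabet with the discrete topology, and let $X\subseteq\mathcal A^{\mathbb Z^d}$ be a subshift, i.e. a set that is closed in the product topology and satisfies $\sigma^jX\subseteq X$ for all $j\in\mathbb Z^d$, where $(\sigma^jx)_i=x_{i+j}$. Put $\Lambda_n=\{i\in\mathbb Z^d:\max_l|i_l|<n\}$, and let $f:X\to\mathbb R$ have $d$-summable variation, $f\in SV_d(X)$, meaning $$\sum_{n\ge1}n^{d-1}\delta_n(f)<\infty,\qquad \delta_n(f)=\sup\{|f(x)-f(y)|:x,y\in X,\ x_{\Lambda_n}=y_{\Lambda_n}\}.$$ Let $\mathfrak T=\{(x,y)\in X\times X: x_{\Lambda^c}=y_{\Lambda^c}\text{ for some finite }\Lambda\subseteq\mathbb Z^d\}$ be the Gibbs relation and let $c_f(x,y)=\sum_{k\in\mathbb Z^d}\big(f(\sigma^ky)-f(\sigma^kx)\big)$ for $(x,y)\in\mathfrak T$. For a Borel probability measure $\mu$ on $X$ let $\nu_r,\nu_s$ be the measures on the Borel subsets $C$ of $\mathfrak T$ given by $$\nu_r(C)=\int_X|\{y:(x,y)\in C\}|\,d\mu(x),\qquad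 \nu_s(C)=\int_X|\{x:(x,y)\in C\}|\,d\mu(y).$$ The measure $\mu$ is a Gibbs measure for $f$ if it is $(c_f,\mathfrak T)$-conformal: for every Borel set $A\subseteq X$ with $\mu(A)=0$, the saturation $\{y:\exists x\in A,\ (x,y)\in\mathfrak T\}$ has $\mu$-measure $0$, and $\frac{d\nu_r}{d\nu_s}=e^{-c_f}$ almost everywhere. For a set $\Delta\subseteq\mathbb Z^d$ let $\mathcal B_{\Delta}$ be the $\sigma$-algebra on $X$ generated by the coordinates in $\Delta$, write $f_n=\sum_{i\in\Lambda_n}f\circ\sigma^i$, and for $\omega\in\mathcal A^{\Lambda}$ write $\omega x_{\Lambda^c}$ for the configuration equal to $\omega$ on $\Lambda$ and to $x$ on $\Lambda^c$. Theorem. Let $\mu$ be a Gibbs measure for $f\in SV_d(X)$. Then for every finite $\Lambda\subseteq\mathbb Z^d$ and every Borel set $A\subseteq X$, the limit $$\gamma_\Lambda(A|x)=\lim_{n\to\infty}\frac{\sum_{\omega\in\mathcal A^\Lambda}e^{f_n(\omega x_{\Lambda^c})}\mathbf 1_{\{\omega x_{\Lambda^c}\in A\}}}{\sum_{\eta\in\mathcal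 A^\Lambda}e^{f_n(\eta x_{\Lambda^c})}\mathbf 1_{\{\eta x_{\Lambda^c}\in X\}}}$$ exists for every $x\in X$, and $\mu$ satisfies the DLR equation $$\mu(A\,|\,\mathcal B_{\Lambda^c})=\gamma_\Lambda(A|\cdot)\qquad\mu\text{-a.e.}$$ -/

import Mathlib

open MeasureTheory Filter Topology
open scoped ENNReal

/-! ### Conformal measures for relations on a measurable space -/

/-- The saturation `R(S)` of a set `S` under the relation `R`. -/
def relSaturation {X : Type*} (R : Set (X × X)) (S : Set X) : Set X :=
  {y | ∃ x ∈ S, (x, y) ∈ R}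

/-- The left counting measure `ν_r` of `μ` on the relation `R`:
`ν_r(C) = ∫ |r⁻¹(x) ∩ C| dμ(x)` with `r(x, y) = x`. The relation `R ⊆ X × X` carries the trace of
the product σ-algebra. -/
noncomputable def leftCountingMeasure {X : Type*} [MeasurableSpace X] (R : Set (X × X))
    (μ : Measure X) : Measure R :=
  μ.bind fun x => Measure.count.restrict {p : R | p.1.1 = x}

/-- The right counting measure `ν_s` of `μ` on the relation `R`:
`ν_s(C) = ∫ |s⁻¹(x) ∩ C| dμ(x)` with `s(x, y) = y`. -/
noncomputable def rightCountingMeasure {X : Type*} [MeasurableSpace X] (R : Set (X × X))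
    (μ : Measure X) : Measure R :=
  μ.bind fun x => Measure.count.restrict {p : R | p.1.2 = x}

/-- `μ` is quasi-invariant under `R`: the saturation of a null Borel set is null. -/
def IsQuasiInvariant {X : Type*} [MeasurableSpace X] (R : Set (X × X)) (μ : Measure X) : Prop :=
  ∀ S : Set X, MeasurableSet S → μ S = 0 → μ (relSaturation R S) = 0

/-- A probability measure `μ` is `(c, R)`-conformal if it is quasi-invariant under `R` and its
Radon-Nikodym derivative `D_{μ,R} = dν_r / dν_s` equals `e^{-c}` almost everywhere. -/
def IsConformal {X : Type*} [MeasurableSpace X] (R : Set (X × X)) (c : R → ℝ)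
    (μ : Measure X) : Prop :=
  IsProbabilityMeasure μ ∧ IsQuasiInvariant R μ ∧
    (leftCountingMeasure R μ).rnDeriv (rightCountingMeasure R μ)
      =ᵐ[rightCountingMeasure R μ] fun p => ENNReal.ofReal (Real.exp (-c p))

/-! ### Subshifts of `A ^ (ℤ ^ d)` -/

open SymbolicDynamics.FullShift

/-- The box `Λ_n = {i ∈ ℤ^d : max_l |i_l| < n}`. -/
noncomputable def latticeBox (d n : ℕ) : Finset (Fin d → ℤ) :=
  Fintype.piFinset fun _ => Finset.Ioo (-(n : ℤ)) (n : ℤ)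

/-- The configuration `ω x_{Λᶜ}`, equal to `ω` on `Λ` and to `x` off `Λ`. -/
def glue {d : ℕ} {A : Type*} (Λ : Finset (Fin d → ℤ)) (ω : Λ → A) (x : (Fin d → ℤ) → A) :
    (Fin d → ℤ) → A :=
  fun i => if h : i ∈ Λ then ω ⟨i, h⟩ else x i

section

variable {d : ℕ} {A : Type*} [TopologicalSpace A]

/-- The shift `σ^j` acting on the points of the subshift `X`, `(σ^j x)_i = x_{i+j}`. -/
def subshiftShift (X : Subshift A (Fin d → ℤ)) (j : Fin d → ℤ) (x : X.carrier) : X.carrier :=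
  ⟨shift j x.1, X.mapsTo j x.2⟩

/-- The `n`-th variation `δ_n(f)`, an extended non-negative real. -/
noncomputable def variation (X : Subshift A (Fin d → ℤ)) (f : X.carrier → ℝ) (n : ℕ) : ℝ≥0∞ :=
  ⨆ (x : X.carrier) (y : X.carrier) (_ : ∀ i ∈ latticeBox d n, x.1 i = y.1 i),
    ENNReal.ofReal |f x - f y|

/-- `f ∈ SV_d(X)`: `∑_{n ≥ 1} n^{d-1} δ_n(f) < ∞` (the sum is indexed by `n + 1`, `n ≥ 0`). -/
def HasSummableVariation (X : Subshift A (Fin d → ℤ)) (f : X.carrier → ℝ) : Prop :=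
  ∑' n : ℕ, ((n + 1 : ℕ) : ℝ≥0∞) ^ (d - 1) * variation X f (n + 1) < ∞

/-- The Gibbs relation `𝔗`: pairs of points of `X` that agree off a finite set of sites. -/
def gibbsRelation (X : Subshift A (Fin d → ℤ)) : Set (X.carrier × X.carrier) :=
  {p | ∃ Λ : Finset (Fin d → ℤ), ∀ i ∉ Λ, p.1.1 i = p.2.1 i}

/-- The cocycle `c_f(x, y) = ∑_{k ∈ ℤ^d} (f(σ^k y) - f(σ^k x))` (an unordered sum). -/
noncomputable def gibbsCocycle (X : Subshift A (Fin d → ℤ)) (f : X.carrier → ℝ)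
    (p : gibbsRelation X) : ℝ :=
  ∑' k : Fin d → ℤ, (f (subshiftShift X k p.1.2) - f (subshiftShift X k p.1.1))

/-- A Gibbs measure for `f` is a `(c_f, 𝔗)`-conformal probability measure on `X`. -/
def IsGibbsMeasure [MeasurableSpace A] (X : Subshift A (Fin d → ℤ)) (f : X.carrier → ℝ)
    (μ : Measure X.carrier) : Prop :=
  IsConformal (gibbsRelation X) (gibbsCocycle X f) μ

/-- The σ-algebra `𝓑_Δ` on `X` generated by the coordinates in `Δ`. -/
@[reducible] def coordSigma (X : Subshift A (Fin d → ℤ)) (Δ : Set (Fin d → ℤ)) :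
    MeasurableSpace X.carrier :=
  ⨆ i ∈ Δ, MeasurableSpace.comap (fun x : X.carrier => x.1 i) ⊤

/-- `f_n = ∑_{i ∈ Λ_n} f ∘ σ^i`. -/
noncomputable def boxSum (X : Subshift A (Fin d → ℤ)) (f : X.carrier → ℝ) (n : ℕ)
    (x : X.carrier) : ℝ :=
  ∑ i ∈ latticeBox d n, f (subshiftShift X i x)

open Classical in
/-- `e^{f_n(z)} 𝟙_{z ∈ B}` for a configuration `z` and `B ⊆ X`; it is `0` if `z ∉ X`. -/
noncomputable def boxWeight (X : Subshift A (Fin d → ℤ)) (f : X.carrier → ℝ) (n : ℕ)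
    (B : Set X.carrier) (z : (Fin d → ℤ) → A) : ℝ :=
  if h : ∃ hz : z ∈ X.carrier, (⟨z, hz⟩ : X.carrier) ∈ B then
    Real.exp (boxSum X f n ⟨z, h.1⟩) else 0

/-- The finite-volume ratio whose limit in `n` is `γ_Λ(B | x)`. -/
noncomputable def gibbsRatio [Fintype A] (X : Subshift A (Fin d → ℤ)) (f : X.carrier → ℝ)
    (Λ : Finset (Fin d → ℤ)) (B : Set X.carrier) (x : X.carrier) (n : ℕ) : ℝ :=
  (∑ ω : Λ → A, boxWeight X f n B (glue Λ ω x.1)) /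
    ∑ η : Λ → A, boxWeight X f n Set.univ (glue Λ η x.1)

/-- The kernel `γ_Λ(B | x) = lim_n (∑_ω e^{f_n(ω x_{Λᶜ})} 𝟙_{ω x_{Λᶜ} ∈ B}) /
(∑_η e^{f_n(η x_{Λᶜ})} 𝟙_{η x_{Λᶜ} ∈ X})`. -/
noncomputable def gibbsKernel [Fintype A] (X : Subshift A (Fin d → ℤ)) (f : X.carrier → ℝ)
    (Λ : Finset (Fin d → ℤ)) (B : Set X.carrier) (x : X.carrier) : ℝ :=
  limUnder atTop (gibbsRatio X f Λ B x)

end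

/-! ### The counting measures of the Gibbs relation are given by their defining formulas -/

theorem measurable_glue {d : ℕ} {A : Type*} [MeasurableSpace A] (Λ : Finset (Fin d → ℤ)) (ω : Λ → A) :
    Measurable (glue (A := A) Λ ω) := by
  refine measurable_pi_lambda _ fun i => ?_
  by_cases h : i ∈ Λ
  · simp [glue, h]
  · simpa [glue, h] using measurable_pi_apply i

section

variable {d : ℕ} {A : Type*} [Finite A] [TopologicalSpace A] [DiscreteTopology A]
  [MeasurableSpace A] [BorelSpace A]

theorem measurableSet_gibbsRelation (X : Subshift A (Fin d → ℤ)) :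
    MeasurableSet (gibbsRelation X) := by
  have : gibbsRelation X = ⋃ Λ : Finset (Fin d → ℤ), ⋂ i : Fin d → ℤ, ⋂ _ : i ∉ Λ,
      {p : X.carrier × X.carrier | p.1.1 i = p.2.1 i} := by
    ext p; simp [gibbsRelation]
  rw [this]
  refine MeasurableSet.iUnion fun Λ => MeasurableSet.iInter fun i => MeasurableSet.iInter fun _ => ?_
  exact measurableSet_eq_fun
    ((measurable_pi_apply i).comp (measurable_subtype_coe.comp measurable_fst))
    ((measurable_pi_apply i).comp (measurable_subtype_coe.comp measurable_snd))

theorem measurable_encard_fst (X : Subshift A (Fin d → ℤ)) {C : Set (gibbsRelation X)}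
    (hC : MeasurableSet C) :
    Measurable fun x : X.carrier =>
      (Measure.count : Measure (gibbsRelation X)) (C ∩ {p | p.1.1 = x}) := by
  classical
  have := Fintype.ofFinite A
  let e : gibbsRelation X → ((Fin d → ℤ) → A) × ((Fin d → ℤ) → A) := fun p => (p.1.1.1, p.1.2.1)
  have hX : MeasurableSet X.carrier := X.isClosed.measurableSet
  have he : MeasurableEmbedding e :=
    ((MeasurableEmbedding.subtype_coe hX).prodMap (MeasurableEmbedding.subtype_coe hX)).comp
      (MeasurableEmbedding.subtype_coe (measurableSet_gibbsRelation X))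
  have hD : MeasurableSet (e '' C) := he.measurableSet_image.2 hC
  let T : Finset (Fin d → ℤ) → Set (gibbsRelation X) := fun Λ => {p | ∀ i ∉ Λ, p.1.1.1 i = p.1.2.1 i}
  have hfin : ∀ Λ (x : X.carrier),
      (Measure.count : Measure (gibbsRelation X)) (C ∩ {p | p.1.1 = x} ∩ T Λ) =
        ∑ ω : Λ → A, if (x.1, glue Λ ω x.1) ∈ e '' C then (1 : ℝ≥0∞) else 0 := by
    intro Λ x
    have hinj : Set.InjOn (fun (p : gibbsRelation X) (i : Λ) => p.1.2.1 i.1)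
        (C ∩ {p | p.1.1 = x} ∩ T Λ) := by
      rintro p ⟨⟨_, hp⟩, hpT⟩ q ⟨⟨_, hq⟩, hqT⟩ hpq
      refine Subtype.ext (Prod.ext (hp.trans hq.symm) (Subtype.ext (funext fun i => ?_)))
      by_cases hi : i ∈ Λ
      · exact congrFun hpq ⟨i, hi⟩
      · rw [← hpT i hi, ← hqT i hi, hp, hq]
    have himg : (fun (p : gibbsRelation X) (i : Λ) => p.1.2.1 i.1) ''
        (C ∩ {p | p.1.1 = x} ∩ T Λ) =
        ((Finset.univ.filter fun ω : Λ → A => (x.1, glue Λ ω x.1) ∈ e '' C : Finset (Λ → A)) :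
          Set (Λ → A)) := by
      ext ω
      simp only [Finset.coe_filter, Finset.mem_univ, true_and, Set.mem_ofPred_eq, Set.mem_image]
      constructor
      · rintro ⟨p, ⟨⟨hpC, hp⟩, hpT⟩, rfl⟩
        refine ⟨p, hpC, Prod.ext (congrArg Subtype.val hp) (funext fun i => ?_)⟩
        by_cases hi : i ∈ Λ
        · simp [e, glue, hi]
        · simp only [e, glue, hi, dite_false]
          rw [← hpT i hi, hp]
      · rintro ⟨p, hpC, hp⟩
        have h1 : p.1.1.1 = x.1 := congrArg Prod.fst hp
        have h2 : p.1.2.1 = glue Λ ω x.1 := congrArg Prod.snd hp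
        refine ⟨p, ⟨⟨hpC, Subtype.ext h1⟩, fun i hi => ?_⟩, funext fun i => ?_⟩
        · rw [h1, h2]; simp [glue, hi]
        · rw [h2]; simp [glue]
    have hSfin : (C ∩ {p | p.1.1 = x} ∩ T Λ).Finite :=
      Set.Finite.of_finite_image (himg ▸ Finset.finite_toSet _) hinj
    rw [Measure.count_apply hSfin.measurableSet, ← hinj.encard_image, himg,
      Set.encard_coe_eq_coe_finsetCard, Finset.sum_boole]
    simp
  have hsup : ∀ x : X.carrier,
      (Measure.count : Measure (gibbsRelation X)) (C ∩ {p | p.1.1 = x}) =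
        ⨆ Λ, (Measure.count : Measure (gibbsRelation X)) (C ∩ {p | p.1.1 = x} ∩ T Λ) := by
    intro x
    have hu : C ∩ {p | p.1.1 = x} = ⋃ Λ, C ∩ {p | p.1.1 = x} ∩ T Λ := by
      rw [← Set.inter_iUnion, eq_comm, Set.inter_eq_left]
      rintro p -
      obtain ⟨Λ, h⟩ := p.2
      exact Set.mem_iUnion.2 ⟨Λ, h⟩
    have hdir : Directed (· ⊆ ·) fun Λ => C ∩ {p : gibbsRelation X | p.1.1 = x} ∩ T Λ := by
      intro Λ Λ'
      refine ⟨Λ ∪ Λ', ?_, ?_⟩ <;> refine Set.inter_subset_inter_right _ fun p hp i hi => hp i ?_ <;>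
        simp_all
    conv_lhs => rw [hu]
    exact hdir.measure_iUnion
  simp_rw [hsup, hfin]
  refine Measurable.iSup fun Λ => Finset.measurable_sum _ fun ω _ => ?_
  refine Measurable.ite ?_ measurable_const measurable_const
  exact (measurable_subtype_coe.prodMk
    ((measurable_glue Λ ω).comp measurable_subtype_coe)) hD

theorem measurable_encard_snd (X : Subshift A (Fin d → ℤ)) {C : Set (gibbsRelation X)}
    (hC : MeasurableSet C) :
    Measurable fun x : X.carrier =>
      (Measure.count : Measure (gibbsRelation X)) (C ∩ {p | p.1.2 = x}) := by
  let θ : gibbsRelation X ≃ᵐ gibbsRelation X :=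
    { toFun := fun p => ⟨p.1.swap, p.2.imp fun _ h i hi => (h i hi).symm⟩
      invFun := fun p => ⟨p.1.swap, p.2.imp fun _ h i hi => (h i hi).symm⟩
      left_inv := fun _ => rfl
      right_inv := fun _ => rfl
      measurable_toFun := (measurable_swap.comp measurable_subtype_coe).subtype_mk
      measurable_invFun := (measurable_swap.comp measurable_subtype_coe).subtype_mk }
  convert measurable_encard_fst X (θ.measurable hC) using 2 with x
  have h1 : MeasurableSet {p : gibbsRelation X | p.1.1 = x} :=
    (measurable_fst.comp measurable_subtype_coe) (measurableSet_singleton x)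
  have h2 : MeasurableSet {p : gibbsRelation X | p.1.2 = x} :=
    (measurable_snd.comp measurable_subtype_coe) (measurableSet_singleton x)
  rw [Measure.count_apply (hC.inter h2), Measure.count_apply ((θ.measurable hC).inter h1),
    ← (θ.injective).encard_image]
  congr 2
  ext p
  constructor
  · rintro ⟨q, ⟨hq, hx⟩, rfl⟩
    exact ⟨hq, hx⟩
  · rintro ⟨hp, hx⟩
    exact ⟨θ p, ⟨hp, hx⟩, rfl⟩

theorem leftCountingMeasure_gibbsRelation_apply (X : Subshift A (Fin d → ℤ))
    (μ : Measure X.carrier) {C : Set (gibbsRelation X)} (hC : MeasurableSet C) :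
    leftCountingMeasure (gibbsRelation X) μ C =
      ∫⁻ x, (({p : gibbsRelation X | p.1.1 = x} ∩ C).encard : ℝ≥0∞) ∂μ := by
  have hm : Measurable fun x : X.carrier =>
      (Measure.count : Measure (gibbsRelation X)).restrict {p | p.1.1 = x} := by
    refine Measure.measurable_of_measurable_coe _ fun S hS => ?_
    simpa only [Measure.restrict_apply hS] using measurable_encard_fst X hS
  rw [leftCountingMeasure, Measure.bind_apply hC hm.aemeasurable]
  refine lintegral_congr fun x => ?_
  rw [Measure.restrict_apply hC, Set.inter_comm, Measure.count_apply]
  exact ((measurable_fst.comp measurable_subtype_coe) (measurableSet_singleton x)).inter hC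

theorem rightCountingMeasure_gibbsRelation_apply (X : Subshift A (Fin d → ℤ))
    (μ : Measure X.carrier) {C : Set (gibbsRelation X)} (hC : MeasurableSet C) :
    rightCountingMeasure (gibbsRelation X) μ C =
      ∫⁻ x, (({p : gibbsRelation X | p.1.2 = x} ∩ C).encard : ℝ≥0∞) ∂μ := by
  have hm : Measurable fun x : X.carrier =>
      (Measure.count : Measure (gibbsRelation X)).restrict {p | p.1.2 = x} := by
    refine Measure.measurable_of_measurable_coe _ fun S hS => ?_
    simpa only [Measure.restrict_apply hS] using measurable_encard_snd X hS
  rw [rightCountingMeasure, Measure.bind_apply hC hm.aemeasurable]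
  refine lintegral_congr fun x => ?_
  rw [Measure.restrict_apply hC, Set.inter_comm, Measure.count_apply]
  exact ((measurable_snd.comp measurable_subtype_coe) (measurableSet_singleton x)).inter hC

end

/-! ### Summability of the cocycle -/

/-! If `x` and `y` agree off a finite set, then for large `|k|` the points `σ^k x` and `σ^k y` agree
on a box of radius about `|k|/2`. There are `O(n^(d-1))` sites with `|k|/2` near `n`, so
`d`-summable variation makes the series for `c_f(x, y)` converge absolutely, and `f_n(y) - f_n(x)`
tends to `c_f(x, y)`. Dividing numerator and denominator of the finite-volume ratio by `e^{f_n(x)}`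
shows that the limit exists (`tendsto_gibbsRatio`) and equals the sum of `e^{c_f(x, y)}` over the `y
∈ B` in the fiber of `x`, divided by the full fiber sum `Z(x)`.

For the DLR equation, conformality becomes a change of variables on the pairs agreeing off `Λ`
(`IsGibbsMeasure.lintegral_fiberSum`): `∫ ∑_y H(x, y) dμ(x) = ∫ ∑_x e^{c_f(y, x)} H(x, y) dμ(y)`.
Apply it to `H(x, y) = 1_{B ∩ C}(x) / Z(y)` with `C` in the σ-algebra of the coordinates off `Λ`. By
the cocycle identity `1 / Z(y) = e^{c_f(x, y)} / Z(x)`, which sums to `1` over `y`, so the left side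
is `μ(B ∩ C)`. Since `C` is a union of fibers, the right side is `∫_C γ_Λ(B | y) dμ(y)`. Uniqueness
of the conditional expectation finishes the proof. -/

theorem mem_latticeBox {d n : ℕ} {k : Fin d → ℤ} :
    k ∈ latticeBox d n ↔ ∀ l, (k l).natAbs < n := by
  simp only [latticeBox, Fintype.mem_piFinset, Finset.mem_Ioo]
  exact forall_congr' fun l => by omega

theorem latticeBox_mono (d : ℕ) : Monotone (latticeBox d) := fun _ _ h _ hk =>
  mem_latticeBox.2 fun l => (mem_latticeBox.1 hk l).trans_le h

theorem exists_subset_latticeBox {d : ℕ} (Λ : Finset (Fin d → ℤ)) : ∃ N, Λ ⊆ latticeBox d N := by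
  refine ⟨Λ.sup (fun k => Finset.univ.sup fun l => (k l).natAbs) + 1, fun k hk => ?_⟩
  refine mem_latticeBox.2 fun l => Nat.lt_succ_of_le ?_
  exact (Finset.le_sup (f := fun l => (k l).natAbs) (Finset.mem_univ l)).trans
    (Finset.le_sup (f := fun k : Fin d → ℤ => Finset.univ.sup fun l => (k l).natAbs) hk)

theorem tendsto_latticeBox (d : ℕ) : Tendsto (latticeBox d) atTop atTop := by
  refine tendsto_atTop_finset_of_monotone (latticeBox_mono d) fun k => ?_
  obtain ⟨N, hN⟩ := exists_subset_latticeBox {k}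
  exact ⟨N, hN (Finset.mem_singleton_self k)⟩

theorem card_latticeBox (d n : ℕ) : (latticeBox d n).card = (2 * n - 1) ^ d := by
  have h : ((n : ℤ) + n).toNat = 2 * n := by omega
  simp [latticeBox, Fintype.card_piFinset, h]

theorem card_latticeBox_sdiff_le {d : ℕ} (hd : 0 < d) (n : ℕ) :
    (latticeBox d (2 * n + 2) \ latticeBox d (2 * n)).card ≤
      d * 4 ^ d * (n + 1) ^ (d - 1) := by
  rw [Finset.card_sdiff_of_subset (latticeBox_mono d (by omega)), card_latticeBox, card_latticeBox]
  set a := 2 * (2 * n + 2) - 1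
  set b := 2 * (2 * n) - 1
  have hab : b ≤ a := by omega
  have h := abs_pow_sub_pow_le (a : ℤ) (b : ℤ) d
  have h1 : (a : ℤ) ^ d - (b : ℤ) ^ d ≤ 4 * d * (4 * (n + 1)) ^ (d - 1) := by
    refine (le_abs_self _).trans (h.trans ?_)
    -- The difference is exactly `4` for `n ≥ 1`; for `n = 0` truncated subtraction gives `b = 0`
    -- and `a = 3`.
    have h2 : |(a : ℤ) - b| ≤ 4 := abs_le.2 ⟨by omega, by omega⟩
    have h3 : max |(a : ℤ)| |(b : ℤ)| ≤ 4 * (n + 1) := max_le (abs_le.2 ⟨by omega, by omega⟩)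
      (abs_le.2 ⟨by omega, by omega⟩)
    gcongr
  obtain ⟨e, rfl⟩ : ∃ e, d = e + 1 := ⟨d - 1, by omega⟩
  rw [Nat.sub_le_iff_le_add]
  zify
  rw [Nat.add_sub_cancel, mul_pow] at h1
  rw [Nat.add_sub_cancel]
  push_cast at h1
  rw [pow_succ (4 : ℤ)]
  linarith

/-- The sup norm of a lattice site. -/
def latticeRadius {d : ℕ} (k : Fin d → ℤ) : ℕ := Finset.univ.sup fun l => (k l).natAbs

theorem natAbs_le_latticeRadius {d : ℕ} (k : Fin d → ℤ) (l : Fin d) :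
    (k l).natAbs ≤ latticeRadius k :=
  Finset.le_sup (f := fun l => (k l).natAbs) (Finset.mem_univ l)

/-- Sites are grouped by half their radius: the class of `n` consists of radii `2n` and `2n + 1`, a
shell with `O((n+1)^(d-1))` points. This is where the weight `n^(d-1)` of `SV_d` enters. -/
theorem tsum_latticeRadius_div_two_le {d : ℕ} (hd : 0 < d) (F : ℕ → ℝ≥0∞) :
    ∑' k : Fin d → ℤ, F (latticeRadius k / 2) ≤
      ((d * 4 ^ d : ℕ) : ℝ≥0∞) * ∑' n : ℕ, ((n + 1 : ℕ) : ℝ≥0∞) ^ (d - 1) * F n := by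
  rw [← ENNReal.tsum_fiberwise _ fun k : Fin d → ℤ => latticeRadius k / 2,
    ← ENNReal.tsum_mul_left]
  refine ENNReal.tsum_le_tsum fun n => ?_
  set S := (fun k : Fin d → ℤ => latticeRadius k / 2) ⁻¹' {n} with hS
  have hsub : S ⊆ (latticeBox d (2 * n + 2) \ latticeBox d (2 * n) : Finset (Fin d → ℤ)) := by
    intro k hk
    have hk' : latticeRadius k / 2 = n := hk
    simp only [Finset.coe_sdiff, Set.mem_sdiff, Finset.mem_coe, mem_latticeBox]
    refine ⟨fun l => ?_, fun h => ?_⟩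
    · have := natAbs_le_latticeRadius k l
      omega
    · have h0 := h ⟨0, hd⟩
      have : latticeRadius k < 2 * n := (Finset.sup_lt_iff (by simp; omega)).2 fun l _ => h l
      omega
  have hcard : (S.encard : ℝ≥0∞) ≤ ((d * 4 ^ d * (n + 1) ^ (d - 1) : ℕ) : ℝ≥0∞) := by
    have h1 := Set.encard_le_encard hsub
    rw [Set.encard_coe_eq_coe_finsetCard] at h1
    have h2 : S.encard ≤ ((d * 4 ^ d * (n + 1) ^ (d - 1) : ℕ) : ℕ∞) :=
      h1.trans (by exact_mod_cast card_latticeBox_sdiff_le hd n)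
    exact_mod_cast ENat.toENNReal_le.2 h2
  calc ∑' k : S, F (latticeRadius k.1 / 2) = ∑' _ : S, F n :=
        tsum_congr fun k => congrArg F k.2
    _ = S.encard * F n := ENNReal.tsum_set_const _ _
    _ ≤ ((d * 4 ^ d * (n + 1) ^ (d - 1) : ℕ) : ℝ≥0∞) * F n := by gcongr
    _ = _ := by push_cast; ring

section

variable {d : ℕ} {A : Type*} [TopologicalSpace A] {X : Subshift A (Fin d → ℤ)} {f : X.carrier → ℝ}

theorem ofReal_abs_sub_le_variation {n : ℕ} {x y : X.carrier}
    (h : ∀ i ∈ latticeBox d n, x.1 i = y.1 i) :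
    ENNReal.ofReal |f x - f y| ≤ variation X f n :=
  le_iSup_of_le x (le_iSup_of_le y (le_iSup_of_le h le_rfl))

theorem HasSummableVariation.tsum_ne_top (hf : HasSummableVariation X f) :
    ∑' n : ℕ, ((n + 1 : ℕ) : ℝ≥0∞) ^ (d - 1) * variation X f (n + 1) ≠ ∞ :=
  (show _ < ∞ from hf).ne

theorem HasSummableVariation.tsum_variation_ne_top (hf : HasSummableVariation X f) :
    ∑' n : ℕ, variation X f (n + 1) ≠ ∞ := by
  refine ne_top_of_le_ne_top hf.tsum_ne_top (ENNReal.tsum_le_tsum fun n => ?_)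
  refine le_mul_of_one_le_left zero_le (one_le_pow₀ ?_)
  exact_mod_cast Nat.succ_pos n

theorem HasSummableVariation.summable_sub (hd : 0 < d) (hf : HasSummableVariation X f)
    {Λ : Finset (Fin d → ℤ)} {x y : X.carrier} (hxy : ∀ i ∉ Λ, x.1 i = y.1 i) :
    Summable fun k : Fin d → ℤ => f (subshiftShift X k y) - f (subshiftShift X k x) := by
  have hsum : ∑' k : Fin d → ℤ, variation X f (latticeRadius k / 2 + 1) ≠ ∞ :=
    ne_top_of_le_ne_top (ENNReal.mul_ne_top (ENNReal.natCast_ne_top _) hf.tsum_ne_top)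
      (tsum_latticeRadius_div_two_le hd fun n => variation X f (n + 1))
  obtain ⟨N, hN⟩ := exists_subset_latticeBox Λ
  refine (ENNReal.summable_toReal hsum).of_norm_bounded_eventually ?_
  have hfin := (latticeBox d (2 * N + 2)).finite_toSet.compl_mem_cofinite
  filter_upwards [hfin] with k hk
  rw [Real.norm_eq_abs, ← ENNReal.ofReal_le_iff_le_toReal (ENNReal.ne_top_of_tsum_ne_top hsum k)]
  refine ofReal_abs_sub_le_variation fun i hi => (hxy _ fun hmem => ?_).symm
  -- With `|i| ≤ |k|/2` and `|k| ≥ 2N + 2`, the coordinate where `k` attains its radius puts `k + i`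
  -- outside the box of size `N`, hence outside `Λ`.
  have hk' : 2 * N + 2 ≤ latticeRadius k := by
    by_contra! hlt
    exact hk (mem_latticeBox.2 fun l => (natAbs_le_latticeRadius k l).trans_lt hlt)
  obtain ⟨l, -, hl⟩ := Finset.exists_mem_eq_sup Finset.univ ⟨⟨0, hd⟩, Finset.mem_univ _⟩
    fun l => (k l).natAbs
  have h1 := mem_latticeBox.1 hi l
  have h2 := mem_latticeBox.1 (hN hmem) l
  simp only [Pi.add_apply] at h2
  change latticeRadius k = _ at hl
  omega

theorem HasSummableVariation.continuous [DiscreteTopology A] (hf : HasSummableVariation X f) :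
    Continuous f := by
  refine continuous_iff_continuousAt.2 fun x => Metric.tendsto_nhds.2 fun ε hε => ?_
  have h0 := ENNReal.tendsto_atTop_zero_of_tsum_ne_top hf.tsum_variation_ne_top
  obtain ⟨n, hn⟩ := (h0.eventually_lt_const (ENNReal.ofReal_pos.2 hε)).exists
  have hopen : IsOpen {y : X.carrier | ∀ i ∈ latticeBox d (n + 1), y.1 i = x.1 i} := by
    simp only [Set.ofPred_forall]
    exact (latticeBox d (n + 1)).finite_toSet.isOpen_biInter fun i _ =>
      isOpen_discrete (α := A) {x.1 i} |>.preimage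
        (f := fun y : X.carrier => y.1 i) ((continuous_apply i).comp continuous_subtype_val)
  filter_upwards [hopen.mem_nhds fun _ _ => rfl] with y hy
  rw [Real.dist_eq]
  exact (ENNReal.ofReal_lt_ofReal_iff hε).1 ((ofReal_abs_sub_le_variation hy).trans_lt hn)

/-- The boxes exhaust the lattice, so box sums are a cofinal family of partial sums of an
unconditionally convergent series. -/
theorem HasSummableVariation.tendsto_boxSum_sub (hd : 0 < d) (hf : HasSummableVariation X f)
    {Λ : Finset (Fin d → ℤ)} {x y : X.carrier} (hxy : ∀ i ∉ Λ, x.1 i = y.1 i) :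
    Tendsto (fun n => boxSum X f n y - boxSum X f n x) atTop
      (𝓝 (∑' k : Fin d → ℤ, (f (subshiftShift X k y) - f (subshiftShift X k x)))) := by
  simp only [boxSum, ← Finset.sum_sub_distrib]
  exact (hf.summable_sub hd hxy).hasSum.comp (tendsto_latticeBox d)

theorem measurable_subshiftShift [MeasurableSpace A] (k : Fin d → ℤ) :
    Measurable (subshiftShift X k) := by
  refine Measurable.subtype_mk (measurable_pi_lambda _ fun i => ?_)
  exact (measurable_pi_apply (k + i)).comp measurable_subtype_coe

theorem measurable_boxSum [MeasurableSpace A] (hf : Measurable f) (n : ℕ) :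
    Measurable (boxSum X f n) :=
  Finset.measurable_sum _ fun k _ => hf.comp (measurable_subshiftShift k)

end

/-! ### Conformal measures: change of variables -/

theorem IsConformal.leftCountingMeasure_eq_withDensity {X : Type*} [MeasurableSpace X]
    {R : Set (X × X)} {c : R → ℝ} {μ : Measure X} (hμ : IsConformal R c μ)
    (hac : leftCountingMeasure R μ ≪ rightCountingMeasure R μ) :
    leftCountingMeasure R μ =
      (rightCountingMeasure R μ).withDensity fun p => ENNReal.ofReal (Real.exp (-c p)) := by
  -- Without a decomposition the derivative is `0` by convention, while it equals a positive
  -- function almost everywhere. That forces `ν_s = 0`, and then a decomposition exists after all.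
  have hdec : (leftCountingMeasure R μ).HaveLebesgueDecomposition (rightCountingMeasure R μ) := by
    by_contra h
    have h0 := hμ.2.2
    rw [Measure.rnDeriv_of_not_haveLebesgueDecomposition h] at h0
    have h1 : rightCountingMeasure R μ = 0 := by
      rw [← Measure.measure_univ_eq_zero]
      refine measure_mono_null (fun p _ => ?_) h0
      exact fun hp => (ENNReal.ofReal_pos.2 (Real.exp_pos (-c p))).ne hp
    rw [h1] at h
    exact h inferInstance
  rw [← withDensity_congr_ae hμ.2.2, Measure.withDensity_rnDeriv_eq _ _ hac]

theorem setLIntegral_count_eq_sum {α ι : Type*} [MeasurableSpace α] [MeasurableSingletonClass α]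
    [Fintype ι] {S : Set α} (hS : MeasurableSet S) {h : α → ℝ≥0∞} {e : ι → α}
    (he : Function.Injective e) (heS : ∀ i, e i ∈ S)
    (hsupp : ∀ a ∈ S, h a ≠ 0 → a ∈ Set.range e) :
    ∫⁻ a in S, h a ∂Measure.count = ∑ i, h (e i) := by
  rw [← lintegral_indicator hS, lintegral_count, ← he.tsum_eq, tsum_fintype]
  · exact Finset.sum_congr rfl fun i _ => Set.indicator_of_mem (heS i) h
  · intro a ha
    exact hsupp a (Set.mem_of_indicator_ne_zero ha)
      (by rwa [Function.mem_support, Set.indicator_of_mem (Set.mem_of_indicator_ne_zero ha)] at ha)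

/-! ### Sums over the points of `X` that agree with a given point off `Λ`. -/

section

variable {d : ℕ} {A : Type*}

theorem glue_apply_of_mem {Λ : Finset (Fin d → ℤ)} (ω : Λ → A) (x : (Fin d → ℤ) → A) (i : Λ) :
    glue Λ ω x i = ω i := by
  simp [glue]

theorem glue_apply_of_notMem {Λ : Finset (Fin d → ℤ)} (ω : Λ → A) (x : (Fin d → ℤ) → A)
    {i : Fin d → ℤ} (hi : i ∉ Λ) : glue Λ ω x i = x i := by
  simp [glue, hi]

theorem glue_congr {Λ : Finset (Fin d → ℤ)} (ω : Λ → A) {x y : (Fin d → ℤ) → A}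
    (h : ∀ i ∉ Λ, x i = y i) : glue Λ ω x = glue Λ ω y := by
  ext i
  by_cases hi : i ∈ Λ
  · simp [glue, hi]
  · simp [glue, hi, h i hi]

theorem glue_restrict {Λ : Finset (Fin d → ℤ)} {x y : (Fin d → ℤ) → A}
    (h : ∀ i ∉ Λ, x i = y i) : glue Λ (fun i => y i) x = y := by
  ext i
  by_cases hi : i ∈ Λ
  · simp [glue, hi]
  · simp [glue, hi, h i hi]

theorem glue_injective (Λ : Finset (Fin d → ℤ)) (x : (Fin d → ℤ) → A) :
    Function.Injective fun ω : Λ → A => glue Λ ω x := fun ω η h => funext fun i => by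
  simpa only [glue_apply_of_mem] using congrFun h i

variable [TopologicalSpace A]

/-- The sum of `g` over the points of `X` which agree with `x` off `Λ`. -/
noncomputable def fiberSum [Fintype A] (X : Subshift A (Fin d → ℤ)) (Λ : Finset (Fin d → ℤ))
    {M : Type*} [AddCommMonoid M] (g : X.carrier → M) (x : X.carrier) : M :=
  ∑ ω : Λ → A, Function.extend Subtype.val g 0 (glue Λ ω x.1)

section FiberSum

variable [Fintype A] {X : Subshift A (Fin d → ℤ)} {Λ : Finset (Fin d → ℤ)} {M : Type*}
  [AddCommMonoid M]

theorem extend_subtype_val_congr {α : Type*} {s : Set α} {g g' : s → M} {z : α}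
    (h : ∀ hz : z ∈ s, g ⟨z, hz⟩ = g' ⟨z, hz⟩) :
    Function.extend Subtype.val g 0 z = Function.extend Subtype.val g' 0 z := by
  by_cases hz : z ∈ s
  · rw [show z = Subtype.val (⟨z, hz⟩ : s) from rfl, Subtype.val_injective.extend_apply,
      Subtype.val_injective.extend_apply, h hz]
  · rw [Function.extend_apply' _ _ _ (by simpa using hz),
      Function.extend_apply' _ _ _ (by simpa using hz)]

theorem fiberSum_congr {g g' : X.carrier → M} {x : X.carrier}
    (h : ∀ y : X.carrier, (∀ i ∉ Λ, x.1 i = y.1 i) → g y = g' y) :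
    fiberSum X Λ g x = fiberSum X Λ g' x :=
  Finset.sum_congr rfl fun ω _ => extend_subtype_val_congr fun hz =>
    h ⟨_, hz⟩ fun _ hi => (glue_apply_of_notMem ω x.1 hi).symm

theorem fiberSum_congr_point (g : X.carrier → M) {x y : X.carrier}
    (h : ∀ i ∉ Λ, x.1 i = y.1 i) : fiberSum X Λ g x = fiberSum X Λ g y :=
  Finset.sum_congr rfl fun ω _ => by rw [glue_congr ω h]

theorem mul_fiberSum (a : ℝ≥0∞) (g : X.carrier → ℝ≥0∞) (x : X.carrier) :
    fiberSum X Λ (fun y => a * g y) x = a * fiberSum X Λ g x := by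
  rw [fiberSum, fiberSum, Finset.mul_sum]
  refine Finset.sum_congr rfl fun ω _ => ?_
  by_cases hz : glue Λ ω x.1 ∈ X.carrier
  · rw [show glue Λ ω x.1 = Subtype.val (⟨_, hz⟩ : X.carrier) from rfl,
      Subtype.val_injective.extend_apply, Subtype.val_injective.extend_apply]
  · rw [Function.extend_apply' _ _ _ (by simpa using hz),
      Function.extend_apply' _ _ _ (by simpa using hz)]
    simp

theorem le_fiberSum (g : X.carrier → ℝ≥0∞) (x : X.carrier) : g x ≤ fiberSum X Λ g x := by
  refine le_trans (le_of_eq ?_) (Finset.single_le_sum (fun _ _ => zero_le)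
    (Finset.mem_univ fun i : Λ => x.1 i))
  rw [glue_restrict fun _ _ => rfl, Subtype.val_injective.extend_apply]

theorem fiberSum_ne_top {g : X.carrier → ℝ≥0∞} (hg : ∀ y, g y ≠ ∞) (x : X.carrier) :
    fiberSum X Λ g x ≠ ∞ := by
  refine ENNReal.sum_ne_top.2 fun ω _ => ?_
  by_cases hz : glue Λ ω x.1 ∈ X.carrier
  · rw [show glue Λ ω x.1 = Subtype.val (⟨_, hz⟩ : X.carrier) from rfl,
      Subtype.val_injective.extend_apply]
    exact hg _
  · rw [Function.extend_apply' _ _ _ (by simpa using hz)]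
    simp

open Classical in
theorem fiberSum_eq_sum_subtype (g : X.carrier → M) (x : X.carrier) :
    fiberSum X Λ g x = ∑ ω : {ω : Λ → A // glue Λ ω x.1 ∈ X.carrier}, g ⟨_, ω.2⟩ := by
  rw [fiberSum, ← Finset.sum_filter_of_ne (p := fun ω : Λ → A => glue Λ ω x.1 ∈ X.carrier),
    Finset.sum_subtype _ fun ω => by rw [Finset.mem_filter_univ]]
  · refine Finset.sum_congr rfl fun ω _ => ?_
    exact Subtype.val_injective.extend_apply g 0 ⟨_, ω.2⟩
  · intro ω _ h
    by_contra hz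
    exact h (Function.extend_apply' _ _ _ (by simpa using hz))

end FiberSum

/-- The exponential `e^{c_f(x, y)}` of the cocycle of `f`. -/
noncomputable def cocycleWeight {X : Subshift A (Fin d → ℤ)} (f : X.carrier → ℝ)
    (x y : X.carrier) : ℝ≥0∞ :=
  ENNReal.ofReal (Real.exp
    (∑' k : Fin d → ℤ, (f (subshiftShift X k y) - f (subshiftShift X k x))))

/-- Reversing a pair changes the sign of every term of the series, so the identity needs no
summability. -/
theorem cocycleWeight_swap {X : Subshift A (Fin d → ℤ)} (f : X.carrier → ℝ) (p : gibbsRelation X) :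
    ENNReal.ofReal (Real.exp (-gibbsCocycle X f p)) = cocycleWeight f p.1.2 p.1.1 := by
  rw [cocycleWeight, gibbsCocycle, ← tsum_neg]
  simp only [neg_sub]

/-! ### The counting measures on pairs agreeing off `Λ`. -/

variable [Fintype A] [DiscreteTopology A] [MeasurableSpace A] [BorelSpace A]
  {X : Subshift A (Fin d → ℤ)}

theorem measurableSet_agree_off (X : Subshift A (Fin d → ℤ)) (Λ : Finset (Fin d → ℤ)) :
    MeasurableSet {p : gibbsRelation X | ∀ i ∉ Λ, p.1.1.1 i = p.1.2.1 i} := by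
  simp only [Set.ofPred_forall]
  refine MeasurableSet.iInter fun i => MeasurableSet.iInter fun _ => ?_
  exact measurableSet_eq_fun
    ((measurable_pi_apply i).comp (measurable_subtype_coe.comp
      (measurable_fst.comp measurable_subtype_coe)))
    ((measurable_pi_apply i).comp (measurable_subtype_coe.comp
      (measurable_snd.comp measurable_subtype_coe)))

/-- If `C` is `ν_s`-null, the second coordinates of its points form a `μ`-null Borel set. Every
first coordinate lies in the saturation of that set, which quasi-invariance makes null. -/
theorem leftCountingMeasure_absolutelyContinuous {μ : Measure X.carrier}
    (hμ : IsQuasiInvariant (gibbsRelation X) μ) :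
    leftCountingMeasure (gibbsRelation X) μ ≪ rightCountingMeasure (gibbsRelation X) μ := by
  refine Measure.AbsolutelyContinuous.mk fun C hC h0 => ?_
  have hms : ∀ x : X.carrier, MeasurableSet {p : gibbsRelation X | p.1.2 = x} := fun x =>
    (measurable_snd.comp measurable_subtype_coe) (measurableSet_singleton x)
  have hcount : ∀ x : X.carrier,
      (Measure.count : Measure (gibbsRelation X)) (C ∩ {p | p.1.2 = x}) =
        (({p : gibbsRelation X | p.1.2 = x} ∩ C).encard : ℝ≥0∞) := fun x => by
    rw [Set.inter_comm, Measure.count_apply ((hms x).inter hC)]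
  have hmeas := measurable_encard_snd X hC
  rw [rightCountingMeasure_gibbsRelation_apply X μ hC, ← lintegral_congr hcount,
    lintegral_eq_zero_iff hmeas] at h0
  have hsat := hμ _ (hmeas (measurableSet_singleton 0).compl) h0
  rw [leftCountingMeasure_gibbsRelation_apply X μ hC]
  refine lintegral_eq_zero_of_ae_eq_zero ?_
  filter_upwards [measure_eq_zero_iff_ae_notMem.1 hsat] with x hx
  have : {p : gibbsRelation X | p.1.1 = x} ∩ C = ∅ := by
    refine Set.eq_empty_of_forall_notMem fun p hp => hx ?_
    obtain ⟨hpx, hpC⟩ := hp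
    refine ⟨p.1.2, fun h => ?_, ?_⟩
    · have h' : (Measure.count : Measure (gibbsRelation X)) (C ∩ {q | q.1.2 = p.1.2}) = 0 := h
      rw [Measure.count_eq_zero_iff] at h'
      exact Set.notMem_empty p (h' ▸ ⟨hpC, rfl⟩)
    · obtain ⟨Λ, hΛ⟩ := p.2
      refine ⟨Λ, fun i hi => ?_⟩
      rw [← hpx]
      exact (hΛ i hi).symm
  simp [this]

/-- The pairs `(x, y)` agreeing off `Λ` are parametrised injectively by the fillings `ω` of `Λ` for
which the glued configuration lies in `X`. -/
theorem setLIntegral_count_fst (Λ : Finset (Fin d → ℤ)) (H : X.carrier → X.carrier → ℝ≥0∞)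
    (x : X.carrier) :
    ∫⁻ p in {p : gibbsRelation X | p.1.1 = x},
      {p : gibbsRelation X | ∀ i ∉ Λ, p.1.1.1 i = p.1.2.1 i}.indicator
        (fun p => H p.1.1 p.1.2) p ∂Measure.count = fiberSum X Λ (H x) x := by
  classical
  let e : {ω : Λ → A // glue Λ ω x.1 ∈ X.carrier} → gibbsRelation X := fun ω =>
    ⟨(x, ⟨_, ω.2⟩), Λ, fun _ hi => (glue_apply_of_notMem ω.1 x.1 hi).symm⟩
  have he : Function.Injective e := fun ω η h => Subtype.ext (glue_injective Λ x.1
    (congrArg (fun p : gibbsRelation X => p.1.2.1) h))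
  have hS : MeasurableSet {p : gibbsRelation X | p.1.1 = x} :=
    (measurable_fst.comp measurable_subtype_coe) (measurableSet_singleton x)
  rw [setLIntegral_count_eq_sum hS he fun _ => rfl, fiberSum_eq_sum_subtype]
  · exact Finset.sum_congr rfl fun ω _ => Set.indicator_of_mem
      (s := {p : gibbsRelation X | ∀ i ∉ Λ, p.1.1.1 i = p.1.2.1 i})
      (fun _ hi => (glue_apply_of_notMem ω.1 x.1 hi).symm) _
  · rintro ⟨⟨x', y⟩, hp⟩ rfl h0
    have hag : ∀ i ∉ Λ, x'.1 i = y.1 i := Set.mem_of_indicator_ne_zero h0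
    refine ⟨⟨fun i => y.1 i, ?_⟩, ?_⟩
    · rw [glue_restrict hag]; exact y.2
    · exact Subtype.ext (Prod.ext rfl (Subtype.ext (glue_restrict hag)))

theorem setLIntegral_count_snd (Λ : Finset (Fin d → ℤ)) (H : X.carrier → X.carrier → ℝ≥0∞)
    (y : X.carrier) :
    ∫⁻ p in {p : gibbsRelation X | p.1.2 = y},
      {p : gibbsRelation X | ∀ i ∉ Λ, p.1.1.1 i = p.1.2.1 i}.indicator
        (fun p => H p.1.1 p.1.2) p ∂Measure.count = fiberSum X Λ (fun x => H x y) y := by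
  classical
  let e : {ω : Λ → A // glue Λ ω y.1 ∈ X.carrier} → gibbsRelation X := fun ω =>
    ⟨(⟨_, ω.2⟩, y), Λ, fun _ hi => glue_apply_of_notMem ω.1 y.1 hi⟩
  have he : Function.Injective e := fun ω η h => Subtype.ext (glue_injective Λ y.1
    (congrArg (fun p : gibbsRelation X => p.1.1.1) h))
  have hS : MeasurableSet {p : gibbsRelation X | p.1.2 = y} :=
    (measurable_snd.comp measurable_subtype_coe) (measurableSet_singleton y)
  rw [setLIntegral_count_eq_sum hS he fun _ => rfl, fiberSum_eq_sum_subtype]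
  · exact Finset.sum_congr rfl fun ω _ => Set.indicator_of_mem
      (s := {p : gibbsRelation X | ∀ i ∉ Λ, p.1.1.1 i = p.1.2.1 i})
      (fun _ hi => glue_apply_of_notMem ω.1 y.1 hi) _
  · rintro ⟨⟨x, y'⟩, hp⟩ rfl h0
    have hag : ∀ i ∉ Λ, x.1 i = y'.1 i := Set.mem_of_indicator_ne_zero h0
    have hag' : ∀ i ∉ Λ, y'.1 i = x.1 i := fun i hi => (hag i hi).symm
    refine ⟨⟨fun i => x.1 i, ?_⟩, ?_⟩
    · rw [glue_restrict hag']; exact x.2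
    · exact Subtype.ext (Prod.ext (Subtype.ext (glue_restrict hag')) rfl)

theorem measurable_restrict_count_fst (X : Subshift A (Fin d → ℤ)) :
    Measurable fun x : X.carrier =>
      (Measure.count : Measure (gibbsRelation X)).restrict {p | p.1.1 = x} :=
  Measure.measurable_of_measurable_coe _ fun S hS => by
    simpa only [Measure.restrict_apply hS] using measurable_encard_fst X hS

theorem measurable_restrict_count_snd (X : Subshift A (Fin d → ℤ)) :
    Measurable fun x : X.carrier =>
      (Measure.count : Measure (gibbsRelation X)).restrict {p | p.1.2 = x} :=
  Measure.measurable_of_measurable_coe _ fun S hS => by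
    simpa only [Measure.restrict_apply hS] using measurable_encard_snd X hS

/-- Change of variables along the Gibbs relation, restricted to the pairs agreeing off `Λ`. -/
theorem IsGibbsMeasure.lintegral_fiberSum {f : X.carrier → ℝ} {μ : Measure X.carrier}
    (hμ : IsGibbsMeasure X f μ) (Λ : Finset (Fin d → ℤ)) {H : X.carrier → X.carrier → ℝ≥0∞}
    (hH : Measurable (Function.uncurry H)) :
    ∫⁻ x, fiberSum X Λ (H x) x ∂μ =
      ∫⁻ y, fiberSum X Λ (fun x => cocycleWeight f y x * H x y) y ∂μ := by
  have hc : IsConformal (gibbsRelation X) (gibbsCocycle X f) μ := hμ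
  -- Measurability of `e^{-c_f}` is read off from the Radon-Nikodym derivative it equals almost
  -- everywhere, so no regularity of `f` is needed.
  have hden : AEMeasurable (fun p => ENNReal.ofReal (Real.exp (-gibbsCocycle X f p)))
      (rightCountingMeasure (gibbsRelation X) μ) :=
    (Measure.measurable_rnDeriv _ _).aemeasurable.congr hc.2.2
  set T := {p : gibbsRelation X | ∀ i ∉ Λ, p.1.1.1 i = p.1.2.1 i}
  have hT : MeasurableSet T := measurableSet_agree_off X Λ
  have hh : Measurable (T.indicator fun p : gibbsRelation X => H p.1.1 p.1.2) :=
    (hH.comp measurable_subtype_coe).indicator hT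
  have hleft : ∫⁻ p, T.indicator (fun p : gibbsRelation X => H p.1.1 p.1.2) p
      ∂leftCountingMeasure (gibbsRelation X) μ = ∫⁻ x, fiberSum X Λ (H x) x ∂μ := by
    rw [leftCountingMeasure,
      Measure.lintegral_bind (measurable_restrict_count_fst X).aemeasurable hh.aemeasurable]
    exact lintegral_congr fun x => setLIntegral_count_fst Λ H x
  rw [← hleft, hc.leftCountingMeasure_eq_withDensity
    (leftCountingMeasure_absolutelyContinuous hc.2.1),
    lintegral_withDensity_eq_lintegral_mul₀ hden hh.aemeasurable, rightCountingMeasure,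
    Measure.lintegral_bind (measurable_restrict_count_snd X).aemeasurable
      (hden.mul hh.aemeasurable)]
  refine lintegral_congr fun y => ?_
  rw [← setLIntegral_count_snd Λ (fun x y => cocycleWeight f y x * H x y) y]
  refine lintegral_congr fun p => ?_
  simp only [Pi.mul_apply, cocycleWeight_swap]
  exact (Set.indicator_mul_right T (fun p => cocycleWeight f p.1.2 p.1.1)
    fun p : gibbsRelation X => H p.1.1 p.1.2).symm

end

/-! ### The kernel `γ_Λ` -/

section

variable {d : ℕ} {A : Type*} [TopologicalSpace A] {X : Subshift A (Fin d → ℤ)} {f : X.carrier → ℝ}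
  {Λ : Finset (Fin d → ℤ)}

theorem boxWeight_eq_extend (X : Subshift A (Fin d → ℤ)) (f : X.carrier → ℝ) (n : ℕ)
    (B : Set X.carrier) (z : (Fin d → ℤ) → A) :
    boxWeight X f n B z =
      Function.extend Subtype.val (B.indicator fun y => Real.exp (boxSum X f n y)) 0 z := by
  classical
  by_cases hz : z ∈ X.carrier
  · obtain ⟨y, rfl⟩ : ∃ y : X.carrier, y.1 = z := ⟨⟨z, hz⟩, rfl⟩
    rw [Subtype.val_injective.extend_apply]
    by_cases hy : y ∈ B <;> simp [boxWeight, hy]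
  · rw [Function.extend_apply' _ _ _ (by simpa using hz)]
    simp [boxWeight, hz]

theorem gibbsRatio_eq_fiberSum_div [Fintype A] (B : Set X.carrier) (x : X.carrier) (n : ℕ) :
    gibbsRatio X f Λ B x n =
      fiberSum X Λ (B.indicator fun y => Real.exp (boxSum X f n y)) x /
        fiberSum X Λ (Set.univ.indicator fun y => Real.exp (boxSum X f n y)) x := by
  simp only [gibbsRatio, boxWeight_eq_extend, fiberSum]

theorem cocycleWeight_ne_top (x y : X.carrier) : cocycleWeight f x y ≠ ∞ := ENNReal.ofReal_ne_top

theorem cocycleWeight_ne_zero (x y : X.carrier) : cocycleWeight f x y ≠ 0 :=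
  (ENNReal.ofReal_pos.2 (Real.exp_pos _)).ne'

theorem cocycleWeight_mul (hd : 0 < d) (hf : HasSummableVariation X f) {x y z : X.carrier}
    (hxy : ∀ i ∉ Λ, x.1 i = y.1 i) (hyz : ∀ i ∉ Λ, y.1 i = z.1 i) :
    cocycleWeight f x y * cocycleWeight f y z = cocycleWeight f x z := by
  rw [cocycleWeight, cocycleWeight, cocycleWeight, ← ENNReal.ofReal_mul (Real.exp_pos _).le,
    ← Real.exp_add, ← (hf.summable_sub hd hxy).tsum_add (hf.summable_sub hd hyz)]
  simp only [sub_add_sub_cancel']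

variable [Fintype A]

/-- The partition function of the fiber of `x` normalised by the weight of `x`. -/
noncomputable def partitionFunction (f : X.carrier → ℝ) (Λ : Finset (Fin d → ℤ)) (x : X.carrier) :
    ℝ≥0∞ :=
  fiberSum X Λ (cocycleWeight f x) x

theorem partitionFunction_ne_zero (x : X.carrier) : partitionFunction f Λ x ≠ 0 := fun h =>
  cocycleWeight_ne_zero x x (le_zero_iff.1 ((le_fiberSum _ x).trans h.le))

theorem partitionFunction_ne_top (x : X.carrier) : partitionFunction f Λ x ≠ ∞ :=
  fiberSum_ne_top (cocycleWeight_ne_top x) x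

/-- By the cocycle identity, moving the base point within a fiber only rescales all weights by a
common factor. -/
theorem cocycleWeight_mul_partitionFunction (hd : 0 < d) (hf : HasSummableVariation X f)
    {x y : X.carrier} (hxy : ∀ i ∉ Λ, x.1 i = y.1 i) :
    cocycleWeight f x y * partitionFunction f Λ y = partitionFunction f Λ x := by
  rw [partitionFunction, ← mul_fiberSum, ← fiberSum_congr_point _ hxy]
  exact fiberSum_congr fun z hz => cocycleWeight_mul hd hf hxy fun i hi =>
    (hxy i hi).symm.trans (hz i hi)

/-- On the fiber of `x` one has `1 / Z(y) = e^{c_f(x, y)} / Z(x)`: the reciprocals are the Gibbs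
probabilities of the points `y`. -/
theorem fiberSum_inv_partitionFunction (hd : 0 < d) (hf : HasSummableVariation X f)
    (x : X.carrier) : fiberSum X Λ (fun y => (partitionFunction f Λ y)⁻¹) x = 1 := by
  have h : fiberSum X Λ (fun y => (partitionFunction f Λ y)⁻¹) x =
      fiberSum X Λ (fun y => (partitionFunction f Λ x)⁻¹ * cocycleWeight f x y) x := by
    refine fiberSum_congr fun y hy => ?_
    rw [← cocycleWeight_mul_partitionFunction hd hf hy,
      ENNReal.mul_inv (.inl (cocycleWeight_ne_zero x y)) (.inl (cocycleWeight_ne_top x y)),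
      mul_right_comm, ENNReal.inv_mul_cancel (cocycleWeight_ne_zero x y)
        (cocycleWeight_ne_top x y), one_mul]
  rw [h, mul_fiberSum]
  exact ENNReal.inv_mul_cancel (partitionFunction_ne_zero x) (partitionFunction_ne_top x)

/-- The factor `e^{f_n(x)}` need not converge by itself; dividing by it leaves exponentials of
`f_n(y) - f_n(x)`, finitely many, each with a limit. -/
theorem tendsto_fiberSum_exp (hd : 0 < d) (hf : HasSummableVariation X f) (B : Set X.carrier)
    (x : X.carrier) :
    Tendsto (fun n => fiberSum X Λ (B.indicator fun y => Real.exp (boxSum X f n y)) x /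
        Real.exp (boxSum X f n x)) atTop
      (𝓝 (fiberSum X Λ (B.indicator (cocycleWeight f x)) x).toReal) := by
  classical
  simp only [fiberSum_eq_sum_subtype, Finset.sum_div]
  rw [ENNReal.toReal_sum fun ω _ =>
    ne_top_of_le_ne_top (cocycleWeight_ne_top x _) (Set.indicator_le_self B _ _)]
  refine tendsto_finsetSum _ fun ω _ => ?_
  by_cases hω : (⟨_, ω.2⟩ : X.carrier) ∈ B
  · simp only [Set.indicator_of_mem hω, cocycleWeight, ← Real.exp_sub,
      ENNReal.toReal_ofReal (Real.exp_pos _).le]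
    exact (Real.continuous_exp.tendsto _).comp (hf.tendsto_boxSum_sub hd fun i hi =>
      (glue_apply_of_notMem ω.1 x.1 hi).symm)
  · simp [hω]

/-- The value of `γ_Λ(B | x)`, in terms of the cocycle. -/
noncomputable def gibbsWeight (f : X.carrier → ℝ) (Λ : Finset (Fin d → ℤ)) (B : Set X.carrier)
    (x : X.carrier) : ℝ≥0∞ :=
  fiberSum X Λ (B.indicator (cocycleWeight f x)) x / partitionFunction f Λ x

theorem gibbsWeight_le_one (B : Set X.carrier) (x : X.carrier) : gibbsWeight f Λ B x ≤ 1 := by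
  classical
  refine ENNReal.div_le_of_le_mul ?_
  rw [one_mul, partitionFunction, fiberSum_eq_sum_subtype, fiberSum_eq_sum_subtype]
  exact Finset.sum_le_sum fun _ _ => Set.indicator_le_self B _ _

theorem tendsto_gibbsRatio (hd : 0 < d) (hf : HasSummableVariation X f) (B : Set X.carrier)
    (x : X.carrier) :
    Tendsto (gibbsRatio X f Λ B x) atTop (𝓝 (gibbsWeight f Λ B x).toReal) := by
  have h := (tendsto_fiberSum_exp (Λ := Λ) hd hf B x).div
    (tendsto_fiberSum_exp (Λ := Λ) hd hf Set.univ x)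
    (by
      rw [Set.indicator_univ]
      exact ENNReal.toReal_ne_zero.2 ⟨partitionFunction_ne_zero x, partitionFunction_ne_top x⟩)
  rw [Set.indicator_univ, ← ENNReal.toReal_div] at h
  refine h.congr fun n => ?_
  simp only [Pi.div_apply, gibbsRatio_eq_fiberSum_div,
    div_div_div_cancel_right₀ (Real.exp_pos (boxSum X f n x)).ne']

theorem gibbsKernel_eq_toReal (hd : 0 < d) (hf : HasSummableVariation X f) (B : Set X.carrier)
    (x : X.carrier) : gibbsKernel X f Λ B x = (gibbsWeight f Λ B x).toReal :=
  (tendsto_gibbsRatio hd hf B x).limUnder_eq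

end

/-! ### Measurability with respect to the coordinates off `Λ` -/

section

variable {d : ℕ} {A : Type*} [TopologicalSpace A] {X : Subshift A (Fin d → ℤ)} {f : X.carrier → ℝ}
  {Λ : Finset (Fin d → ℤ)}

theorem coordSigma_le [Finite A] [DiscreteTopology A] [MeasurableSpace A] [BorelSpace A]
    (X : Subshift A (Fin d → ℤ)) (Δ : Set (Fin d → ℤ)) :
    coordSigma X Δ ≤ (inferInstance : MeasurableSpace X.carrier) := by
  refine iSup₂_le fun i _ => ?_
  rintro _ ⟨s, -, rfl⟩
  exact ((measurable_pi_apply i).comp measurable_subtype_coe) (Set.toFinite s).measurableSet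

theorem mem_iff_of_measurableSet_coordSigma {Δ : Set (Fin d → ℤ)} {C : Set X.carrier}
    (hC : MeasurableSet[coordSigma X Δ] C) {x y : X.carrier} (h : ∀ i ∈ Δ, x.1 i = y.1 i) :
    x ∈ C ↔ y ∈ C := by
  -- Comparison with the pullback of all subsets under restriction to `Δ` writes `C` directly as a
  -- preimage, without induction on measurable sets.
  have hle : coordSigma X Δ ≤
      MeasurableSpace.comap (fun (x : X.carrier) (i : Δ) => x.1 i) ⊤ := by
    refine iSup₂_le fun i hi => ?_
    rintro _ ⟨s, -, rfl⟩
    exact ⟨{z | z ⟨i, hi⟩ ∈ s}, trivial, rfl⟩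
  obtain ⟨s, -, rfl⟩ := hle _ hC
  rw [Set.mem_preimage, Set.mem_preimage, funext fun i : Δ => h i i.2]

theorem measurable_glue_coordSigma [MeasurableSpace A] (ω : Λ → A) :
    Measurable[coordSigma X (Λ : Set (Fin d → ℤ))ᶜ] fun x : X.carrier => glue Λ ω x.1 := by
  let := coordSigma X (Λ : Set (Fin d → ℤ))ᶜ
  refine @measurable_pi_lambda _ _ _ (_) _ _ fun i => ?_
  by_cases hi : i ∈ Λ
  · simp [glue, hi]
  · simp only [glue, hi, dite_false]
    intro s _
    exact (le_iSup₂_of_le (f := fun i (_ : i ∈ (Λ : Set (Fin d → ℤ))ᶜ) =>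
      MeasurableSpace.comap (fun x : X.carrier => x.1 i) ⊤) i (by simpa using hi) le_rfl)
      _ ⟨s, trivial, rfl⟩

variable [Fintype A] [DiscreteTopology A] [MeasurableSpace A] [BorelSpace A]

theorem measurable_fiberSum {g : X.carrier → ℝ} (hg : Measurable g) :
    Measurable[coordSigma X (Λ : Set (Fin d → ℤ))ᶜ] (fiberSum X Λ g) := by
  refine Finset.measurable_sum _ fun ω _ => ?_
  exact ((MeasurableEmbedding.subtype_coe X.isClosed.measurableSet).measurable_extend hg
    measurable_zero).comp (measurable_glue_coordSigma ω)

theorem HasSummableVariation.measurable_indicator_exp (hf : HasSummableVariation X f)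
    {B : Set X.carrier} (hB : MeasurableSet B) (n : ℕ) :
    Measurable (B.indicator fun y => Real.exp (boxSum X f n y)) :=
  (measurable_boxSum hf.continuous.measurable n).exp.indicator hB

theorem measurable_gibbsKernel (hd : 0 < d) (hf : HasSummableVariation X f) {B : Set X.carrier}
    (hB : MeasurableSet B) :
    Measurable[coordSigma X (Λ : Set (Fin d → ℤ))ᶜ] (gibbsKernel X f Λ B) := by
  let m := coordSigma X (Λ : Set (Fin d → ℤ))ᶜ
  refine @measurable_of_tendsto_metrizable _ _ m _ _ _ _ (fun n x => gibbsRatio X f Λ B x n) _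
    (fun n => ?_) (tendsto_pi_nhds.2 fun x => ?_)
  · simp only [gibbsRatio_eq_fiberSum_div]
    exact (measurable_fiberSum (hf.measurable_indicator_exp hB n)).div
      (measurable_fiberSum (hf.measurable_indicator_exp MeasurableSet.univ n))
  · rw [gibbsKernel_eq_toReal hd hf]
    exact tendsto_gibbsRatio hd hf B x

/-- `Z` is normalised by the weight of `x` itself, so it may depend on the coordinates in `Λ`; Borel
measurability is what the change of variables requires. -/
theorem measurable_partitionFunction (hd : 0 < d) (hf : HasSummableVariation X f) :
    Measurable (partitionFunction f Λ) := by
  have h : Measurable fun x => (partitionFunction f Λ x).toReal := by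
    refine measurable_of_tendsto_metrizable (f := fun n x =>
      fiberSum X Λ (Set.univ.indicator fun y => Real.exp (boxSum X f n y)) x /
        Real.exp (boxSum X f n x)) (fun n => ?_) (tendsto_pi_nhds.2 fun x => ?_)
    · exact ((measurable_fiberSum (hf.measurable_indicator_exp MeasurableSet.univ n)).mono
        (coordSigma_le X _) le_rfl).div (measurable_boxSum hf.continuous.measurable n).exp
    · have := tendsto_fiberSum_exp (Λ := Λ) hd hf Set.univ x
      rwa [Set.indicator_univ] at this
  have h' := h.ennreal_ofReal
  simpa only [ENNReal.ofReal_toReal (partitionFunction_ne_top _)] using h'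

/-! ### The DLR equation -/

theorem IsGibbsMeasure.setLIntegral_gibbsWeight (hd : 0 < d) (hf : HasSummableVariation X f)
    {μ : Measure X.carrier} (hμ : IsGibbsMeasure X f μ) {B C : Set X.carrier}
    (hB : MeasurableSet B) (hC : MeasurableSet[coordSigma X (Λ : Set (Fin d → ℤ))ᶜ] C) :
    ∫⁻ x in C, gibbsWeight f Λ B x ∂μ = μ (B ∩ C) := by
  have hC' : MeasurableSet C := coordSigma_le X _ _ hC
  -- The factor `1 / Z(y)` makes the sum over `y` equal to `1` on the left and supplies the
  -- normalisation of `γ_Λ` on the right.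
  have hH : Measurable (Function.uncurry fun x y : X.carrier =>
      (B ∩ C).indicator (fun _ => (1 : ℝ≥0∞)) x * (partitionFunction f Λ y)⁻¹) :=
    ((measurable_const.indicator (hB.inter hC')).comp measurable_fst).mul
      ((measurable_partitionFunction hd hf).inv.comp measurable_snd)
  have key := hμ.lintegral_fiberSum Λ hH
  simp only [mul_fiberSum, fiberSum_inv_partitionFunction hd hf, mul_one] at key
  rw [lintegral_indicator_const (hB.inter hC'), one_mul] at key
  rw [key, ← lintegral_indicator hC']
  refine lintegral_congr fun y => ?_
  have : fiberSum X Λ (fun x => cocycleWeight f y x *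
        ((B ∩ C).indicator (fun _ => (1 : ℝ≥0∞)) x * (partitionFunction f Λ y)⁻¹)) y =
      fiberSum X Λ (fun x => (C.indicator (fun _ => (1 : ℝ≥0∞)) y * (partitionFunction f Λ y)⁻¹) *
        B.indicator (cocycleWeight f y) x) y := by
    refine fiberSum_congr fun x hyx => ?_
    -- Membership in `C` ignores the coordinates in `Λ`, so its indicator can be taken at `y` and
    -- leaves the fiber sum.
    have hCiff : y ∈ C ↔ x ∈ C := mem_iff_of_measurableSet_coordSigma hC fun i hi =>
      hyx i (by simpa using hi)
    by_cases hxB : x ∈ B <;> by_cases hxC : x ∈ C <;> simp [hxB, hxC, hCiff, mul_comm]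
  rw [this, mul_fiberSum]
  by_cases hy : y ∈ C
  · simp [hy, gibbsWeight, ENNReal.div_eq_inv_mul]
  · simp [hy]

end

theorem mainTheorem2 {d : ℕ} (hd : 0 < d) {A : Type*} [Fintype A] [TopologicalSpace A]
    [DiscreteTopology A] [MeasurableSpace A] [BorelSpace A]
    (X : SymbolicDynamics.FullShift.Subshift A (Fin d → ℤ)) (f : X.carrier → ℝ)
    (hf : HasSummableVariation X f) (μ : Measure X.carrier) (hμ : IsGibbsMeasure X f μ)
    (Λ : Finset (Fin d → ℤ)) (B : Set X.carrier) (hB : MeasurableSet B) :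
    (∀ x : X.carrier, Tendsto (gibbsRatio X f Λ B x) atTop (𝓝 (gibbsKernel X f Λ B x))) ∧
      μ[B.indicator (fun _ => (1 : ℝ)) | coordSigma X ((Λ : Set (Fin d → ℤ))ᶜ)]
        =ᵐ[μ] fun x => gibbsKernel X f Λ B x := by
  refine ⟨fun x => ?_, ?_⟩
  · rw [gibbsKernel_eq_toReal hd hf]
    exact tendsto_gibbsRatio hd hf B x
  have : IsProbabilityMeasure μ := hμ.1
  have hm := coordSigma_le X (Λ : Set (Fin d → ℤ))ᶜ
  have hmeas := measurable_gibbsKernel (Λ := Λ) hd hf hB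
  have htop : ∀ x, gibbsWeight f Λ B x < ∞ := fun x =>
    (gibbsWeight_le_one B x).trans_lt ENNReal.one_lt_top
  have hwmeas : Measurable (gibbsWeight f Λ B) := by
    have := (hmeas.mono hm le_rfl).ennreal_ofReal
    simpa only [gibbsKernel_eq_toReal hd hf, ENNReal.ofReal_toReal (htop _).ne] using this
  have hint : Integrable (gibbsKernel X f Λ B) μ := by
    refine .of_bound (hmeas.mono hm le_rfl).aestronglyMeasurable 1 (ae_of_all _ fun x => ?_)
    rw [gibbsKernel_eq_toReal hd hf, Real.norm_of_nonneg ENNReal.toReal_nonneg]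
    exact ENNReal.toReal_le_of_le_ofReal zero_le_one (by simpa using gibbsWeight_le_one B x)
  -- The kernel is measurable for the coordinates off `Λ`, so equality of integrals over all such
  -- `C` characterises it as the conditional expectation.
  refine (ae_eq_condExp_of_forall_setIntegral_eq hm ((integrable_const 1).indicator hB)
    (fun _ _ _ => hint.integrableOn) (fun C hC _ => ?_)
    hmeas.stronglyMeasurable.aestronglyMeasurable).symm
  simp only [gibbsKernel_eq_toReal hd hf]
  rw [integral_toReal hwmeas.aemeasurable (ae_of_all _ htop),
    hμ.setLIntegral_gibbsWeight hd hf hB hC, integral_indicator_const _ hB,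
    measureReal_restrict_apply hB]
  simp [Measure.real]
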